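/- Let $d\ge 1$ be an integer, and let $K_d$ be the complete graph on $d$ vertices with vertex set $V$. A divisor on $K_d$ is a function $D:V\to\mathbb Z$; its degree is $\deg D=\sum_{v}D(v)$, and it is effective if $D(v)\ge 0$ for all $v$. For $f:V\to\mathbb Z$ let $\operatorname{div}(f)(v)=\sum_{w\ne v}(f(v)-f(w))$; two divisors are linearly equivalent if their difference is $\operatorname{div}(f)$ for some $f$. The linear system $|D|$ is the set of effective divisors linearly equivalent to $D$. The rank $\operatorname{rk}(D)$ is $-1$ if $|D|=\emptyset$, and otherwise it is the largest integer $r\ge 0$ such that $|D-E|\neq\emptyset$ for every effective divisor $E$ of degree $r$. For $r\ge 1$ let \[\gamma_r=\min\{\deg D : D \text{ a divisor on } K_d \text{ with } \operatorname{rk}(D)=r\}.\] Then the genus $g=|E(K_d)|-|V|+1$ of $K_d$ equals $\frac{(d-1)(d-2)}{2}$, and for every integer $r\ge 1$ the minimum defining $\gamma_r$ exists and \[\gamma_r=\begin{cases} kd-h & \text{if } r<g,\\ g+r & \text{if } r\ge g,\end{cases}\] where, in the case $r<g$, $k$ and $h$ are the integers with $1\le k\le d-3$, $0\le h\le k$ and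 $r=\frac{k(k+3)}{2}-h$; these exist and are uniquely determined by $r$. -/

import Mathlib

namespace GraphDiv

variable {V : Type*} [Fintype V]

/-- Divisors on a finite graph: formal integer combinations of its vertices, that is, their
coefficient functions. -/
abbrev Divisor (V : Type*) : Type _ := V → ℤ

/-- The degree of a divisor: the sum of its coefficients. -/
def degree (D : Divisor V) : ℤ := ∑ v, D v

/-- A divisor is effective if all its coefficients are nonnegative. -/
def Effective {V : Type*} (D : Divisor V) : Prop := ∀ v, 0 ≤ D v

/-- The principal divisor of `f`, with coefficient `∑_{vw ∈ E(G)} (f v - f w)` at `v`. -/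
def principal (G : SimpleGraph V) [DecidableRel G.Adj] (f : V → ℤ) : Divisor V :=
  fun v => ∑ w ∈ G.neighborFinset v, (f v - f w)

/-- Linear equivalence of divisors. -/
def LinEquiv (G : SimpleGraph V) [DecidableRel G.Adj] (D₁ D₂ : Divisor V) : Prop :=
  ∃ f : V → ℤ, D₁ - D₂ = principal G f

/-- The linear system `|D|`: the effective divisors linearly equivalent to `D`. -/
def linearSystem (G : SimpleGraph V) [DecidableRel G.Adj] (D : Divisor V) : Set (Divisor V) :=
  {E | Effective E ∧ LinEquiv G E D}

/-- The set of `r ≥ 0` such that `|D - E| ≠ ∅` for every effective divisor `E` of degree `r`. -/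
def rankSet (G : SimpleGraph V) [DecidableRel G.Adj] (D : Divisor V) : Set ℕ :=
  {r | ∀ E : Divisor V, Effective E → degree E = r → (linearSystem G (D - E)).Nonempty}

open Classical in
/-- The rank of a divisor: `-1` if `|D| = ∅`, and otherwise the maximum of `rankSet G D`
(attained on every graph with a vertex, see `isGreatest_rankSet`). -/
noncomputable def rank (G : SimpleGraph V) [DecidableRel G.Adj] (D : Divisor V) : ℤ :=
  if (linearSystem G D).Nonempty then ((sSup (rankSet G D) : ℕ) : ℤ) else -1

/-- `s` is the `r`-th gonality of `G`: the minimal degree of a divisor of rank `r`. -/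
def IsGonality (G : SimpleGraph V) [DecidableRel G.Adj] (r s : ℤ) : Prop :=
  IsLeast {t : ℤ | ∃ D : Divisor V, degree D = t ∧ rank G D = r} s

/-- The genus `|E(G)| - |V(G)| + 1` of a connected graph. -/
def genus (G : SimpleGraph V) [DecidableRel G.Adj] : ℤ :=
  (G.edgeFinset.card : ℤ) - (Fintype.card V : ℤ) + 1

theorem degree_principal (G : SimpleGraph V) [DecidableRel G.Adj] (f : V → ℤ) :
    degree (principal G f) = 0 := by
  have h : degree (principal G f) = ∑ v, ∑ w, if G.Adj v w then f v - f w else 0 := by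
    simp only [degree, principal, SimpleGraph.neighborFinset_eq_filter, Finset.sum_filter]
  have h' : degree (principal G f) = -degree (principal G f) := by
    conv_lhs => rw [h, Finset.sum_comm]
    rw [h, ← Finset.sum_neg_distrib]
    refine Finset.sum_congr rfl fun v _ => ?_
    rw [← Finset.sum_neg_distrib]
    refine Finset.sum_congr rfl fun w _ => ?_
    by_cases hvw : G.Adj v w
    · simp [hvw, hvw.symm]
    · have : ¬ G.Adj w v := fun h => hvw h.symm
      simp [hvw, this]
  omega

/-- The maximum in the definition of the rank exists. -/
theorem isGreatest_rankSet [Nonempty V] (G : SimpleGraph V) [DecidableRel G.Adj] (D : Divisor V)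
    (hD : (linearSystem G D).Nonempty) : IsGreatest (rankSet G D) (sSup (rankSet G D)) := by
  classical
  have hbdd : BddAbove (rankSet G D) := by
    refine ⟨(degree D).toNat, fun r hr => ?_⟩
    obtain ⟨v⟩ := ‹Nonempty V›
    obtain ⟨F, hF, f, hf⟩ := hr (Pi.single v (r : ℤ))
      (fun w => by by_cases h : w = v <;> simp [h]) (by simp [degree])
    have h1 : degree (F - (D - Pi.single v (r : ℤ))) = 0 := by rw [hf, degree_principal]
    have h2 : 0 ≤ degree F := Finset.sum_nonneg fun w _ => hF w
    have h3 : ∑ w, (Pi.single v (r : ℤ) : V → ℤ) w = r := by simp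
    simp only [degree, Pi.sub_apply, Finset.sum_sub_distrib, h3] at h1 h2 ⊢
    omega
  have h0 : (0 : ℕ) ∈ rankSet G D := by
    intro E hE hdeg
    have hz : E = 0 := by
      funext v
      exact (Finset.sum_eq_zero_iff_of_nonneg (fun w _ => hE w)).1
        (by simpa [degree] using hdeg) v (Finset.mem_univ v)
    simpa [hz] using hD
  exact ⟨Nat.sSup_mem ⟨0, h0⟩ hbdd, fun r hr => le_csSup hbdd hr⟩

end GraphDiv

/-! Let n be the number of vertices. On the complete graph, a divisor F is equivalent to no
effective divisor exactly when F < b pointwise for some b whose values form a complete residue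
system modulo n with sum n(n-1)/2 (`exists_isBalancedResidues_gt`,
`linearSystem_top_eq_empty_of_lt`). Hence r lies in the rank set of D exactly when ∑ max(0, D + 1 -
b) > r for every such b.

For the constant divisor k < n these sums are at least 1 + ⋯ + (k+1), so its rank is at least
k(k+3)/2, and removing h chips costs at most h (`mem_rankSet_const_sub`).

Conversely, given D, take b closest to D + 1 in Euclidean distance. An exchange argument shows that
the values of b - (D + 1) have no gaps, so triangular numbers bound its positive and negative parts.
The degree of D ties the two parts together, and the better of the two bounds keeps ∑ max(0, D + 1 -
b) at most r when the degree is too small. For r ≥ g, degree g + r suffices for any divisor, and the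
same choice of b shows that less does not. -/

namespace GraphDiv

/-! ### Sums of distinct or gap-free integers -/

section IntegerSums

variable {ι : Type*}

/-- Distinct positive integers are at least as large as `1, 2, …, #s` in sum. -/
theorem card_mul_succ_le_two_mul_sum [DecidableEq ι] (s : Finset ι) (u : ι → ℤ)
    (hpos : ∀ i ∈ s, 1 ≤ u i) (hinj : Set.InjOn u s) :
    (s.card : ℤ) * (s.card + 1) ≤ 2 * ∑ i ∈ s, u i := by
  induction hn : s.card generalizing s with
  | zero => simpa using Finset.sum_nonneg fun i hi => by linarith [hpos i hi]
  | succ n ih =>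
    have hne : s.Nonempty := Finset.card_pos.1 (by omega)
    obtain ⟨a, ha, hmax⟩ := s.exists_max_image u hne
    have hcard : (s.card : ℤ) ≤ u a := by
      have h1 : s.image u ⊆ Finset.Icc 1 (u a) := fun y hy => by
        obtain ⟨i, hi, rfl⟩ := Finset.mem_image.1 hy
        exact Finset.mem_Icc.2 ⟨hpos i hi, hmax i hi⟩
      have h2 := Finset.card_le_card h1
      rw [Finset.card_image_of_injOn hinj, Int.card_Icc] at h2
      have := hpos a ha
      omega
    have h := ih (s.erase a) (fun i hi => hpos i (Finset.mem_of_mem_erase hi))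
      (hinj.mono (by simp)) (by rw [Finset.card_erase_of_mem ha]; omega)
    rw [← Finset.add_sum_erase s u ha]
    rw [hn] at hcard
    push_cast at hcard ⊢
    nlinarith

/-- Positive integers whose values leave no gap down to `1` are at most as large as
`1, 2, …, #s` in sum. -/
theorem two_mul_sum_le_card_mul_succ [DecidableEq ι] (s : Finset ι) (u : ι → ℤ)
    (hpos : ∀ i ∈ s, 1 ≤ u i) (hgap : ∀ i ∈ s, ∀ t, 1 ≤ t → t < u i → ∃ j ∈ s, u j = t) :
    2 * ∑ i ∈ s, u i ≤ (s.card : ℤ) * (s.card + 1) := by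
  induction hn : s.card generalizing s with
  | zero => simp [Finset.card_eq_zero.1 hn]
  | succ n ih =>
    have hne : s.Nonempty := Finset.card_pos.1 (by omega)
    obtain ⟨a, ha, hmax⟩ := s.exists_max_image u hne
    have hcard : u a ≤ s.card := by
      have h1 : Finset.Icc 1 (u a) ⊆ s.image u := fun t ht => by
        rw [Finset.mem_Icc] at ht
        rcases ht.2.lt_or_eq with h | h
        · exact Finset.mem_image.2 (hgap a ha t ht.1 h)
        · exact Finset.mem_image.2 ⟨a, ha, h.symm⟩
      have h2 := (Finset.card_le_card h1).trans Finset.card_image_le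
      rw [Int.card_Icc] at h2
      omega
    have h := ih (s.erase a) (fun i hi => hpos i (Finset.mem_of_mem_erase hi))
      (fun i hi t h1 h2 => by
        obtain ⟨j, hj, hjt⟩ := hgap i (Finset.mem_of_mem_erase hi) t h1 h2
        have := hmax i (Finset.mem_of_mem_erase hi)
        exact ⟨j, Finset.mem_erase.2 ⟨by rintro rfl; omega, hj⟩, hjt⟩)
      (by rw [Finset.card_erase_of_mem ha]; omega)
    rw [← Finset.add_sum_erase s u ha]
    rw [hn] at hcard
    push_cast at hcard ⊢
    nlinarith

theorem sum_posPart_sub_sum_negPart [Fintype ι] (u : ι → ℤ) :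
    ∑ i, max 0 (u i) - ∑ i, max 0 (-u i) = ∑ i, u i := by
  rw [← Finset.sum_sub_distrib]
  exact Finset.sum_congr rfl fun i _ => by omega

theorem sum_posPart_eq_sum_filter [Fintype ι] (u : ι → ℤ) :
    ∑ i, max 0 (u i) = ∑ i with 1 ≤ u i, u i := by
  rw [Finset.sum_filter]
  exact Finset.sum_congr rfl fun i _ => by split_ifs <;> omega

theorem sum_negPart_eq_sum_filter [Fintype ι] (u : ι → ℤ) :
    ∑ i, max 0 (-u i) =
      ∑ i with ¬ 1 ≤ u i, (1 - u i) - (Finset.univ.filter fun i => ¬ 1 ≤ u i).card := by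
  rw [Finset.card_eq_sum_ones, Nat.cast_sum, ← Finset.sum_sub_distrib, Finset.sum_filter]
  exact Finset.sum_congr rfl fun i _ => by split_ifs <;> push_cast <;> omega

end IntegerSums

/-! ### Complete residue systems and their distance to a given vector -/

section CompleteResidues

variable {V : Type*} [Fintype V]

/-- The integers `b v` form a complete residue system modulo `|V|` with the same sum as
`0, 1, …, |V| - 1`. -/
structure IsBalancedResidues (b : V → ℤ) : Prop where
  injective : Function.Injective fun v => (b v : ZMod (Fintype.card V))
  two_mul_sum : 2 * ∑ v, b v = Fintype.card V * (Fintype.card V - 1)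

/-- Distinctness alone suffices if at least m values lie below m. Otherwise many distinct values are
at least m, and the prescribed sum of b turns their excess into a deficit below m. -/
theorem IsBalancedResidues.mul_succ_le_two_mul_sum {b : V → ℤ} (hb : IsBalancedResidues b) {m : ℤ}
    (hm : m ≤ Fintype.card V) (hm0 : 0 ≤ m) : m * (m + 1) ≤ 2 * ∑ v, max 0 (m - b v) := by
  classical
  have hinj : Function.Injective b := fun v w h => hb.injective (by simp [h])
  set u : V → ℤ := fun v => m - b v with hu
  set s := Finset.univ.filter fun v => 1 ≤ u v with hs
  set s' := Finset.univ.filter fun v => ¬ 1 ≤ u v with hs'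
  have hcard : s.card + s'.card = Fintype.card V := by
    rw [hs, hs', Finset.card_filter_add_card_filter_not, Finset.card_univ]
  have h1 := card_mul_succ_le_two_mul_sum s u (fun i hi => (Finset.mem_filter.1 hi).2)
    (fun v _ w _ h => hinj (by simp only [hu] at h; omega))
  have h2 := card_mul_succ_le_two_mul_sum s' (fun i => 1 - u i)
    (fun i hi => by have : ¬ 1 ≤ u i := (Finset.mem_filter.1 hi).2
                    omega)
    (fun v _ w _ h => hinj (by simp only [hu] at h; omega))
  rw [← sum_posPart_eq_sum_filter u] at h1
  have h3 := sum_negPart_eq_sum_filter u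
  rw [← hs'] at h3
  have h4 := sum_posPart_sub_sum_negPart u
  have h5 : ∑ v, u v = Fintype.card V * m - ∑ v, b v := by
    simp [hu, Finset.sum_sub_distrib]
  have h6 := hb.two_mul_sum
  rcases le_or_gt m s.card with hle | hlt
  · nlinarith
  · have h7 : (s'.card : ℤ) = Fintype.card V - s.card := by omega
    have h8 : (Fintype.card V : ℤ) - m + 1 ≤ s'.card := by omega
    nlinarith

variable [Nonempty V]

theorem card_pos_int : (0 : ℤ) < Fintype.card V := by exact_mod_cast Fintype.card_pos

theorem two_mul_sum_emod {b : V → ℤ}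
    (hb : Function.Injective fun v => (b v : ZMod (Fintype.card V))) :
    2 * ∑ v, b v % (Fintype.card V : ℤ) = Fintype.card V * (Fintype.card V - 1) := by
  classical
  have hn := card_pos_int (V := V)
  set n := Fintype.card V with hnV
  have hinj : Function.Injective fun v => (b v % (n : ℤ)).toNat := fun v w h => by
    apply hb
    have h1 := Int.emod_nonneg (b v) hn.ne'
    have h2 := Int.emod_nonneg (b w) hn.ne'
    exact (ZMod.intCast_eq_intCast_iff _ _ _).2 (show b v % n = b w % n by simp only at h; omega)
  have himg : Finset.univ.image (fun v => (b v % (n : ℤ)).toNat) = Finset.range n := by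
    refine Finset.eq_of_subset_of_card_le (fun y hy => ?_) ?_
    · obtain ⟨v, -, rfl⟩ := Finset.mem_image.1 hy
      have h1 := Int.emod_nonneg (b v) hn.ne'
      have h2 := Int.emod_lt_of_pos (b v) hn
      rw [Finset.mem_range]
      omega
    · rw [Finset.card_image_of_injective _ hinj, Finset.card_range, Finset.card_univ]
  have h1 : ∑ v, b v % (n : ℤ) = ∑ i ∈ Finset.range n, (i : ℤ) := by
    rw [← himg, Finset.sum_image fun v _ w _ h => hinj h]
    exact Finset.sum_congr rfl fun v _ => (Int.toNat_of_nonneg (Int.emod_nonneg _ hn.ne')).symm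
  have h2 := Finset.sum_range_id_mul_two n
  rw [h1, mul_comm]
  zify at h2
  rw [h2, Nat.cast_sub (by omega)]
  simp

theorem exists_isBalancedResidues : ∃ b : V → ℤ, IsBalancedResidues b := by
  have e := Fintype.equivFin V
  have hinj : Function.Injective fun v => (((e v : ℕ) : ℤ) : ZMod (Fintype.card V)) :=
    fun v w h => by
      have h' := (ZMod.intCast_eq_intCast_iff _ _ _).1 h
      apply e.injective
      apply Fin.ext
      have h1 : ((e v : ℕ) : ℤ) % (Fintype.card V : ℤ) = (e w : ℕ) % (Fintype.card V : ℤ) := h'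
      rw [Int.emod_eq_of_lt (by omega) (by exact_mod_cast (e v).2),
        Int.emod_eq_of_lt (by omega) (by exact_mod_cast (e w).2)] at h1
      exact_mod_cast h1
  refine ⟨fun v => ((e v : ℕ) : ℤ), hinj, ?_⟩
  rw [← two_mul_sum_emod hinj]
  congr 1
  exact Finset.sum_congr rfl fun v _ =>
    (Int.emod_eq_of_lt (by omega) (by exact_mod_cast (e v).2)).symm

/-- In a complete residue system split into two nonempty parts, some residue of the first part is
followed by a residue of the second. -/
theorem exists_consecutive_residues {b : V → ℤ}
    (hb : Function.Injective fun v => (b v : ZMod (Fintype.card V))) (p : V → Prop)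
    (hp : ∃ v, p v) (hq : ∃ w, ¬ p w) :
    ∃ v w, p v ∧ ¬ p w ∧ (b w : ZMod (Fintype.card V)) = b v + 1 := by
  have : NeZero (Fintype.card V) := ⟨Fintype.card_ne_zero⟩
  have hsurj := ((Fintype.bijective_iff_injective_and_card _).2
    ⟨hb, (ZMod.card (Fintype.card V)).symm⟩).2
  by_contra! hcon
  obtain ⟨v₀, hv₀⟩ := hp
  obtain ⟨w, hw⟩ := hq
  -- If no such pair existed, `p` would pass from each residue to its successor and so hold
  -- everywhere.
  have key : ∀ j : ℕ, ∀ v, (b v : ZMod (Fintype.card V)) = b v₀ + j → p v := by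
    intro j
    induction j with
    | zero => exact fun v hv => by rwa [hb (a₁ := v) (a₂ := v₀) (by simpa using hv)]
    | succ j ih =>
      intro v hv
      obtain ⟨a, ha⟩ := hsurj (b v₀ + j)
      by_contra hpv
      refine hcon a v (ih a ha) hpv ?_
      simp only at ha
      rw [hv, ha]
      push_cast
      ring
  refine hw (key ((b w : ZMod (Fintype.card V)) - b v₀).val w ?_)
  simp

/-- Among the balanced residue systems, one closest to `x` differs from `x` by a function whose
values form an interval. -/
theorem exists_isBalancedResidues_sub_gapFree (x : V → ℤ) :
    ∃ b : V → ℤ, IsBalancedResidues b ∧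
      ∀ t, (∃ v, b v - x v < t) → (∃ w, t < b w - x w) → ∃ a, b a - x a = t := by
  classical
  obtain ⟨b, hb, hmin⟩ := WellFounded.has_min
    (InvImage.wf (fun b : V → ℤ => (∑ v, (b v - x v) ^ 2).toNat) Nat.lt_wfRel.wf)
    {b | IsBalancedResidues b} exists_isBalancedResidues
  refine ⟨b, hb, fun t ⟨v₀, hv₀⟩ ⟨w₀, hw₀⟩ => ?_⟩
  by_contra! hcon
  obtain ⟨v, w, hv, hw, hvw⟩ := exists_consecutive_residues hb.injective
    (fun v => b v - x v < t) ⟨v₀, hv₀⟩ ⟨w₀, by omega⟩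
  have hw' : t < b w - x w := lt_of_le_of_ne (not_lt.1 hw) (hcon w).symm
  have hne : v ≠ w := by rintro rfl; exact hw hv
  have hsum : ∀ f : V → ℤ, ∑ a, f a = f v + (f w + ∑ a ∈ (Finset.univ.erase v).erase w, f a) :=
    fun f => by
      rw [Finset.add_sum_erase _ f (Finset.mem_erase.2 ⟨hne.symm, Finset.mem_univ w⟩),
        Finset.add_sum_erase _ f (Finset.mem_univ v)]
  -- Moving `b v` up and `b w` down by one exchanges their residue classes and keeps the sum. It
  -- brings the system closer to `x`, since the two differences are at least 2 apart.
  set c : V → ℤ := fun a => if a = v then b v + 1 else if a = w then b w - 1 else b a with hc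
  have hcv : c v = b v + 1 := by simp [hc]
  have hcw : c w = b w - 1 := by simp [hc, hne.symm]
  have hrest : ∀ a ∈ (Finset.univ.erase v).erase w, c a = b a := fun a ha => by
    simp only [Finset.mem_erase] at ha
    simp [hc, ha.1, ha.2.1]
  have hcb : IsBalancedResidues c := by
    refine ⟨?_, ?_⟩
    · have : (fun a => (c a : ZMod (Fintype.card V))) =
          (fun a => (b a : ZMod (Fintype.card V))) ∘ Equiv.swap v w := by
        funext a
        by_cases hav : a = v
        · subst hav
          simp [hcv, hvw]
        · by_cases haw : a = w
          · subst haw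
            simp [hcw, hvw]
          · simp [hc, hav, haw, Equiv.swap_apply_of_ne_of_ne hav haw]
      rw [this]
      exact hb.injective.comp (Equiv.swap v w).injective
    · rw [← hb.two_mul_sum, hsum c, hsum b, Finset.sum_congr rfl hrest, hcv, hcw]
      ring
  refine hmin c hcb ?_
  have hlt : ∑ a, (c a - x a) ^ 2 < ∑ a, (b a - x a) ^ 2 := by
    rw [hsum fun a => (c a - x a) ^ 2, hsum fun a => (b a - x a) ^ 2,
      Finset.sum_congr rfl fun a ha => by rw [hrest a ha], hcv, hcw]
    nlinarith
  have hnn : 0 ≤ ∑ a, (c a - x a) ^ 2 := Finset.sum_nonneg fun a _ => sq_nonneg _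
  show (∑ a, (c a - x a) ^ 2).toNat < (∑ a, (b a - x a) ^ 2).toNat
  omega

/-- Every `x` has a balanced residue system `b` with `x - b` small in the positive direction, in
terms of the number `p` of places where `b` exceeds `x`. -/
theorem exists_isBalancedResidues_bounds (x : V → ℤ) :
    ∃ b : V → ℤ, IsBalancedResidues b ∧ ∃ p : ℤ, 0 ≤ p ∧ p ≤ Fintype.card V ∧
      (p < Fintype.card V → 2 * ∑ v, max 0 (b v - x v) ≤ p * (p + 1)) ∧
      (1 ≤ p → 2 * ∑ v, max 0 (x v - b v) ≤
        (Fintype.card V - p) * (Fintype.card V - p - 1)) := by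
  classical
  obtain ⟨b, hb, hgap⟩ := exists_isBalancedResidues_sub_gapFree x
  set u : V → ℤ := fun v => b v - x v with hu
  set s := Finset.univ.filter fun v => 1 ≤ u v with hs
  set s' := Finset.univ.filter fun v => ¬ 1 ≤ u v with hs'
  have hcard : s.card + s'.card = Fintype.card V := by
    rw [hs, hs', Finset.card_filter_add_card_filter_not, Finset.card_univ]
  refine ⟨b, hb, s.card, by omega, by omega, fun hlt => ?_, fun hp => ?_⟩
  · obtain ⟨v, hv⟩ : s'.Nonempty := Finset.card_pos.1 (by omega)
    have hv' : ¬ 1 ≤ u v := (Finset.mem_filter.1 hv).2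
    have h := two_mul_sum_le_card_mul_succ s u (fun i hi => (Finset.mem_filter.1 hi).2)
      (fun i _ t h1 h2 => by
        obtain ⟨a, ha⟩ := hgap t ⟨v, by simp only [hu] at hv'; omega⟩ ⟨i, h2⟩
        exact ⟨a, by simp [hs, hu, ha, h1], ha⟩)
    rwa [← sum_posPart_eq_sum_filter u] at h
  · obtain ⟨v, hv⟩ : s.Nonempty := Finset.card_pos.1 (by omega)
    have hv' : 1 ≤ u v := (Finset.mem_filter.1 hv).2
    -- The shift `1 - u` makes the nonpositive values positive; undoing it subtracts `s'.card`,
    -- which turns q(q+1) into q(q-1).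
    have h := two_mul_sum_le_card_mul_succ s' (fun i => 1 - u i)
      (fun i hi => by have : ¬ 1 ≤ u i := (Finset.mem_filter.1 hi).2
                      omega)
      (fun i _ t h1 h2 => by
        obtain ⟨a, ha⟩ := hgap (1 - t) ⟨i, by simp only [hu] at h2; omega⟩
          ⟨v, by simp only [hu] at hv'; omega⟩
        exact ⟨a, by simp only [hs', hu, ha, Finset.mem_filter, Finset.mem_univ, true_and]; omega,
          by simp only [hu, ha]; omega⟩)
    have h2 := sum_negPart_eq_sum_filter u
    rw [← hs'] at h2
    have h3 : ∑ v, max 0 (x v - b v) = ∑ v, max 0 (-u v) :=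
      Finset.sum_congr rfl fun v _ => by simp [hu]
    have h4 : (Fintype.card V : ℤ) - s.card = s'.card := by omega
    rw [h3, h2, h4]
    linarith

end CompleteResidues

/-! ### Ranks on general graphs, and floor sums -/

section LinearSystems

variable {V : Type*} [Fintype V]

theorem degree_add (D E : Divisor V) : degree (D + E) = degree D + degree E :=
  Finset.sum_add_distrib

theorem degree_sub (D E : Divisor V) : degree (D - E) = degree D - degree E :=
  Finset.sum_sub_distrib ..

theorem degree_single [DecidableEq V] (v : V) (c : ℤ) : degree (Pi.single v c) = c := by
  simp [degree]

theorem effective_single {V : Type*} [DecidableEq V] (v : V) {c : ℤ} (hc : 0 ≤ c) :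
    Effective (Pi.single v c : Divisor V) := fun w => by
  by_cases h : w = v
  · subst h; simpa using hc
  · simp [h]

theorem Effective.add {V : Type*} {D E : Divisor V} (hD : Effective D) (hE : Effective E) :
    Effective (D + E) := fun v => add_nonneg (hD v) (hE v)

theorem linearSystem_nonempty_mono (G : SimpleGraph V) [DecidableRel G.Adj] {D D' : Divisor V}
    (hle : D ≤ D') (h : (linearSystem G D).Nonempty) : (linearSystem G D').Nonempty := by
  obtain ⟨E, hE, f, hf⟩ := h
  refine ⟨E + (D' - D), hE.add fun v => sub_nonneg.2 (hle v), f, ?_⟩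
  rw [← hf]
  abel

theorem mem_rankSet_mono (G : SimpleGraph V) [DecidableRel G.Adj] {D D' : Divisor V}
    (hle : D ≤ D') {r : ℕ} (h : r ∈ rankSet G D) : r ∈ rankSet G D' := fun E hE hdeg =>
  linearSystem_nonempty_mono G (sub_le_sub_right hle E) (h E hE hdeg)

theorem mem_rankSet_of_le [Nonempty V] (G : SimpleGraph V) [DecidableRel G.Adj] {D : Divisor V}
    {r s : ℕ} (hrs : r ≤ s) (hs : s ∈ rankSet G D) : r ∈ rankSet G D := by
  classical
  obtain ⟨v⟩ := ‹Nonempty V›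
  intro E hE hdeg
  have hc : (0 : ℤ) ≤ s - r := by omega
  refine linearSystem_nonempty_mono G (fun w => ?_)
    (hs (E + Pi.single v ((s : ℤ) - r)) (hE.add (effective_single v hc))
      (by rw [degree_add, degree_single, hdeg]; ring))
  have := effective_single v hc w
  simp only [Pi.sub_apply, Pi.add_apply]
  omega

theorem mem_rankSet_of_rank_eq [Nonempty V] (G : SimpleGraph V) [DecidableRel G.Adj]
    {D : Divisor V} {r : ℕ} (h : rank G D = r) : r ∈ rankSet G D := by
  unfold rank at h
  split_ifs at h with hne
  · rw [← Nat.cast_inj.1 h]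
    exact (isGreatest_rankSet G D hne).1

theorem rank_eq_of_mem_of_notMem [Nonempty V] (G : SimpleGraph V) [DecidableRel G.Adj]
    {D : Divisor V} {r : ℕ} (hr : r ∈ rankSet G D) (hr' : r + 1 ∉ rankSet G D) :
    rank G D = r := by
  have h0 : (linearSystem G D).Nonempty := by
    simpa using mem_rankSet_of_le G (Nat.zero_le r) hr 0 (fun _ => le_rfl) (by simp [degree])
  obtain ⟨hmem, hub⟩ := isGreatest_rankSet G D h0
  have h1 := hub hr
  have h2 : ¬ r + 1 ≤ sSup (rankSet G D) := fun h => hr' (mem_rankSet_of_le G h hmem)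
  rw [rank, if_pos h0]
  omega

theorem add_one_ediv_eq (a : ℤ) {n : ℤ} (hn : 0 < n) :
    (a + 1) / n = a / n + if n ∣ a + 1 then 1 else 0 := by
  have h1 := Int.mul_ediv_add_emod a n
  have h2 := Int.emod_nonneg a hn.ne'
  have h3 := Int.emod_lt_of_pos a hn
  split_ifs with h
  · obtain ⟨q, hq⟩ := h
    rw [hq, Int.mul_ediv_cancel_left _ hn.ne']
    have h4 : n * (q - a / n) = a % n + 1 := by linarith
    have h5 : 0 < q - a / n := by by_contra hc; nlinarith
    have h6 : q - a / n < 2 := by by_contra hc; nlinarith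
    omega
  · have h4 : a % n + 1 ≠ n := fun h' => h ⟨a / n + 1, by linarith⟩
    rw [add_zero]
    refine le_antisymm (Int.lt_add_one_iff.1 ((Int.ediv_lt_iff_lt_mul hn).2 ?_))
      ((Int.le_ediv_iff_mul_le hn).2 ?_)
    · have : a % n + 1 < n := lt_of_le_of_ne h3 h4
      linarith
    · linarith

theorem card_mul_sum_ediv_add_sum_emod (F : V → ℤ) (c : ℤ) :
    Fintype.card V * ∑ v, (F v + c) / (Fintype.card V : ℤ) +
      ∑ v, (F v + c) % (Fintype.card V : ℤ) = degree F + Fintype.card V * c := by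
  rw [Finset.mul_sum, ← Finset.sum_add_distrib,
    Finset.sum_congr rfl fun v _ => Int.mul_ediv_add_emod _ _]
  simp [Finset.sum_add_distrib, degree]

/-- The positive and negative parts of `D + 1 - b` differ by its total, which depends only on the
degree of `D`. -/
theorem sum_posPart_sub_eq {D b : V → ℤ} (hb : IsBalancedResidues b) :
    2 * ∑ v, max 0 (D v + 1 - b v) = 2 * ∑ v, max 0 (b v - (D v + 1)) + 2 * degree D -
      Fintype.card V * (Fintype.card V - 3) := by
  have h1 := sum_posPart_sub_sum_negPart fun v => D v + 1 - b v
  have h2 := hb.two_mul_sum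
  simp only [neg_sub, Finset.sum_sub_distrib, Finset.sum_add_distrib, Finset.sum_const,
    Finset.card_univ, nsmul_eq_mul] at h1
  simp only [degree]
  linarith

end LinearSystems

/-! ### Non-effective classes and rank bounds on the complete graph -/

section CompleteGraph

variable {V : Type*} [Fintype V] [DecidableEq V]

theorem principal_top (f : V → ℤ) (v : V) :
    principal (⊤ : SimpleGraph V) f v = Fintype.card V * f v - ∑ w, f w := by
  have h : ∀ w, w ∉ (⊤ : SimpleGraph V).neighborFinset v → f v - f w = 0 := fun w hw => by
    have : w = v := by simpa using hw
    simp [this]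
  rw [principal, Finset.sum_subset (Finset.subset_univ _) fun w _ hw => h w hw,
    Finset.sum_sub_distrib]
  simp

variable [Nonempty V]

/-- `F + principal ⊤ f` is effective iff `-f v` is at most the floor of (F v + c)/n for all v, where
c = -∑ f. Only the sum of f then remains to be matched. -/
theorem linearSystem_top_nonempty_iff (F : Divisor V) :
    (linearSystem (⊤ : SimpleGraph V) F).Nonempty ↔
      ∃ c : ℤ, c ≤ ∑ v, (F v + c) / (Fintype.card V : ℤ) := by
  have hn := card_pos_int (V := V)
  constructor
  · rintro ⟨E, hE, f, hf⟩
    refine ⟨-∑ v, f v, ?_⟩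
    rw [← Finset.sum_neg_distrib]
    refine Finset.sum_le_sum fun v _ => ?_
    rw [Int.le_ediv_iff_mul_le hn]
    have h1 := congrFun hf v
    rw [principal_top, Pi.sub_apply] at h1
    have h2 := hE v
    rw [Finset.sum_neg_distrib]
    linarith
  · rintro ⟨c, hc⟩
    obtain ⟨v₀⟩ := ‹Nonempty V›
    -- The slack `e` is placed at one vertex so that the sum of `f` is exactly `-c`; increasing `f`
    -- there only adds chips.
    set e : ℤ := ∑ v, (F v + c) / (Fintype.card V : ℤ) - c with he
    set f : V → ℤ := (Pi.single v₀ e : V → ℤ) - fun v => (F v + c) / (Fintype.card V : ℤ) with hf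
    have hsum : ∑ v, f v = -c := by
      simp [hf, Finset.sum_sub_distrib, he]
    refine ⟨F + principal ⊤ f, fun v => ?_, f, by simp⟩
    rw [Pi.add_apply, principal_top, hsum]
    have h1 := effective_single v₀ (show 0 ≤ e by omega) v
    have h2 := Int.ediv_mul_le (F v + c) hn.ne'
    have h3 : f v = (Pi.single v₀ e : V → ℤ) v - (F v + c) / (Fintype.card V : ℤ) := rfl
    rw [h3]
    nlinarith

/-- A divisor below a balanced residue system lowered by one everywhere is not equivalent to an
effective one. -/
theorem linearSystem_top_eq_empty_of_lt {F b : V → ℤ} (hb : IsBalancedResidues b)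
    (hF : ∀ v, F v < b v) : linearSystem (⊤ : SimpleGraph V) F = ∅ := by
  by_contra hne
  obtain ⟨E, hE, f, hf⟩ := Set.nonempty_iff_ne_empty.2 hne
  have hn := card_pos_int (V := V)
  -- `y` dominates the effective divisor `E` and is again a complete residue system, so its sum is
  -- at least n(n-1)/2; but that sum is n less than the sum of `b`.
  set y : V → ℤ := fun v => b v + Fintype.card V * f v - (∑ w, f w + 1) with hy
  have hy0 : ∀ v, 0 ≤ y v := fun v => by
    have h1 := congrFun hf v
    rw [principal_top, Pi.sub_apply] at h1
    have h2 := hE v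
    have h3 := hF v
    simp only [hy]
    omega
  have hinj : Function.Injective fun v => (y v : ZMod (Fintype.card V)) := fun v w h =>
    hb.injective (by simpa [hy] using h)
  have h1 := two_mul_sum_emod hinj
  have h2 : ∑ v, y v % (Fintype.card V : ℤ) ≤ ∑ v, y v :=
    Finset.sum_le_sum fun v _ => by
      have h1 := Int.mul_ediv_add_emod (y v) (Fintype.card V)
      have h2 := mul_nonneg hn.le (Int.ediv_nonneg (hy0 v) hn.le)
      linarith
  have h3 : ∑ v, y v = ∑ v, b v - Fintype.card V := by
    simp only [hy, Finset.sum_sub_distrib, Finset.sum_add_distrib, ← Finset.mul_sum,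
      Finset.sum_const, Finset.card_univ, nsmul_eq_mul]
    ring
  have := hb.two_mul_sum
  omega

/-- A divisor that is not equivalent to an effective one, and is maximal with this property, comes
from a balanced residue system. -/
theorem isBalancedResidues_add_one_of_maximal {F : Divisor V}
    (hF : ¬ (linearSystem (⊤ : SimpleGraph V) F).Nonempty)
    (hmax : ∀ v, (linearSystem (⊤ : SimpleGraph V) (F + Pi.single v 1)).Nonempty) :
    IsBalancedResidues (F + 1) := by
  have hn := card_pos_int (V := V)
  rw [linearSystem_top_nonempty_iff] at hF
  push Not at hF
  set n : ℤ := (Fintype.card V : ℤ) with hnV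
  -- One chip at `v` must lift the floor sum from c - 1 to c, so n divides F v + c + 1. A second
  -- such vertex would make the floor sum at c + 1 reach c + 1, and `F` would be equivalent to an
  -- effective divisor.
  have key : ∀ v, ∃ c, ∑ w, (F w + c) / n = c - 1 ∧ ∀ w, n ∣ F w + c + 1 ↔ w = v := by
    intro v
    obtain ⟨c, hc⟩ := (linearSystem_top_nonempty_iff _).1 (hmax v)
    rw [← hnV] at hc
    have h1 : ∑ w, ((F + Pi.single v 1 : V → ℤ) w + c) / n =
        ∑ w, (F w + c) / n + if n ∣ F v + c + 1 then 1 else 0 := by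
      rw [← Finset.add_sum_erase _ _ (Finset.mem_univ v),
        ← Finset.add_sum_erase _ (fun w => (F w + c) / n) (Finset.mem_univ v),
        Finset.sum_congr rfl (g := fun w => (F w + c) / n) fun w hw => by
          simp [Finset.ne_of_mem_erase hw]]
      have : (F + Pi.single v 1 : V → ℤ) v + c = F v + c + 1 := by simp; ring
      rw [this, add_one_ediv_eq _ hn]
      ring
    have h2 := hF c
    have h3 := hF (c + 1)
    have h4 : ∑ w, (F w + (c + 1)) / n =
        ∑ w, (F w + c) / n + ∑ w, if n ∣ F w + c + 1 then (1 : ℤ) else 0 := by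
      rw [← Finset.sum_add_distrib]
      exact Finset.sum_congr rfl fun w _ => by rw [← add_assoc, add_one_ediv_eq _ hn]
    have hv : n ∣ F v + c + 1 := by
      by_contra hv
      rw [if_neg hv] at h1
      omega
    rw [if_pos hv] at h1
    refine ⟨c, by omega, fun w => ⟨fun hw => ?_, fun hw => hw ▸ hv⟩⟩
    by_contra hwv
    have h5 : ∑ a ∈ {w, v}, (if n ∣ F a + c + 1 then (1 : ℤ) else 0) ≤
        ∑ a, if n ∣ F a + c + 1 then (1 : ℤ) else 0 :=
      Finset.sum_le_sum_of_subset_of_nonneg (Finset.subset_univ _)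
        fun a _ _ => by split_ifs <;> simp
    rw [Finset.sum_pair hwv, if_pos hw, if_pos hv] at h5
    omega
  have hinj : Function.Injective fun v => (F v : ZMod (Fintype.card V)) := fun v w h => by
    obtain ⟨c, -, hc⟩ := key v
    have h1 : n ∣ F v - F w := (ZMod.intCast_eq_intCast_iff_dvd_sub _ _ _).1 h.symm
    have h2 := dvd_sub ((hc v).2 rfl) h1
    exact ((hc w).1 (by rwa [show F v + c + 1 - (F v - F w) = F w + c + 1 by ring] at h2)).symm
  refine ⟨fun v w h => hinj (by simpa using h), ?_⟩
  obtain ⟨v⟩ := ‹Nonempty V›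
  obtain ⟨c, hc, -⟩ := key v
  have h1 := card_mul_sum_ediv_add_sum_emod F c
  have h2 := two_mul_sum_emod (b := fun v => F v + c)
    fun v w h => hinj (by simpa using h)
  rw [← hnV] at h1 h2 ⊢
  rw [hc] at h1
  have h3 : ∑ v, (F + 1 : V → ℤ) v = degree F + n := by
    simp [Finset.sum_add_distrib, degree, hnV]
  rw [h3]
  linarith

/-- Degrees of divisors with empty linear system are bounded, so adding chips while the system stays
empty ends at a maximal such divisor. -/
theorem exists_isBalancedResidues_gt {F : Divisor V}
    (hF : ¬ (linearSystem (⊤ : SimpleGraph V) F).Nonempty) :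
    ∃ b, IsBalancedResidues b ∧ ∀ v, F v < b v := by
  have hn := card_pos_int (V := V)
  have hbound : ∀ F : Divisor V, ¬ (linearSystem (⊤ : SimpleGraph V) F).Nonempty →
      degree F ≤ Fintype.card V * Fintype.card V := by
    intro F hF
    rw [linearSystem_top_nonempty_iff] at hF
    push Not at hF
    have h1 := card_mul_sum_ediv_add_sum_emod F 0
    have h2 : ∑ v, (F v + 0) % (Fintype.card V : ℤ) ≤ ∑ _v : V, (Fintype.card V : ℤ) :=
      Finset.sum_le_sum fun v _ => (Int.emod_lt_of_pos _ hn).le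
    have h3 := hF 0
    simp only [Finset.sum_const, Finset.card_univ, nsmul_eq_mul] at h2
    nlinarith
  induction hN : (Fintype.card V * Fintype.card V - degree F : ℤ).toNat
    generalizing F with
  | zero =>
    have hb := isBalancedResidues_add_one_of_maximal hF fun v => by
      by_contra hv
      have h1 := hbound _ hv
      rw [degree_add, degree_single] at h1
      omega
    exact ⟨F + 1, hb, fun v => by simp⟩
  | succ N ih =>
    by_cases hmax : ∀ v, (linearSystem (⊤ : SimpleGraph V) (F + Pi.single v 1)).Nonempty
    · exact ⟨F + 1, isBalancedResidues_add_one_of_maximal hF hmax, fun v => by simp⟩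
    · push Not at hmax
      obtain ⟨v, hv⟩ := hmax
      obtain ⟨b, hb, hlt⟩ := ih (F := F + Pi.single v 1) (by rwa [Set.not_nonempty_iff_eq_empty])
        (by rw [degree_add, degree_single]; omega)
      refine ⟨b, hb, fun w => lt_of_le_of_lt ?_ (hlt w)⟩
      have := effective_single v (zero_le_one' ℤ) w
      simp only [Pi.add_apply]
      omega

theorem linearSystem_top_nonempty_of_le_degree {F : Divisor V}
    (hF : ((Fintype.card V : ℤ) - 1) * (Fintype.card V - 2) ≤ 2 * degree F) :
    (linearSystem (⊤ : SimpleGraph V) F).Nonempty := by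
  by_contra hne
  obtain ⟨b, hb, hlt⟩ := exists_isBalancedResidues_gt hne
  have h1 : ∑ v, (F v + 1) ≤ ∑ v, b v := Finset.sum_le_sum fun v _ => hlt v
  have h2 := hb.two_mul_sum
  rw [Finset.sum_add_distrib] at h1
  simp only [Finset.sum_const, Finset.card_univ, nsmul_eq_mul, degree] at h1 hF
  nlinarith

/-- The multiple `k` of the all-ones divisor, less `j` chips, has rank at least
`k (k + 3) / 2 - j`. -/
theorem mem_rankSet_const_sub {k : ℤ} {D : Divisor V} (hk : 0 ≤ k) (hk' : k + 1 ≤ Fintype.card V)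
    {J : Divisor V} (hJ : Effective J) (hD : D = (fun _ => k) - J) {r : ℕ}
    (hr : 2 * (r + degree J) ≤ k * (k + 3)) : r ∈ rankSet (⊤ : SimpleGraph V) D := by
  intro E hE hdeg
  by_contra hne
  obtain ⟨b, hb, hlt⟩ := exists_isBalancedResidues_gt hne
  have h1 := hb.mul_succ_le_two_mul_sum hk' (by omega)
  have h2 : ∑ v, max 0 (k + 1 - b v) ≤ ∑ v, (J v + E v) := Finset.sum_le_sum fun v _ => by
    have h3 := hlt v
    have h4 := hE v
    have h5 := hJ v
    simp only [hD, Pi.sub_apply] at h3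
    omega
  rw [Finset.sum_add_distrib] at h2
  simp only [degree] at hr hdeg
  nlinarith

theorem mem_rankSet_of_le_degree {D : Divisor V} {r : ℕ}
    (hD : ((Fintype.card V : ℤ) - 1) * (Fintype.card V - 2) + 2 * r ≤ 2 * degree D) :
    r ∈ rankSet (⊤ : SimpleGraph V) D := fun E _ hdeg =>
  linearSystem_top_nonempty_of_le_degree (by rw [degree_sub, hdeg]; linarith)

/-- Removing the positive part of `D + 1 - b`, padded to degree r, leaves a divisor below `b`. -/
theorem notMem_rankSet_of_sum_posPart_le {D : Divisor V} {b : V → ℤ} {r : ℕ}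
    (hb : IsBalancedResidues b) (h : ∑ v, max 0 (D v + 1 - b v) ≤ r) :
    r ∉ rankSet (⊤ : SimpleGraph V) D := by
  intro hr
  obtain ⟨v₀⟩ := ‹Nonempty V›
  set P : Divisor V := fun v => max 0 (D v + 1 - b v) with hP
  have hs := effective_single v₀ (sub_nonneg.2 (show degree P ≤ r from h))
  have hne := hr (P + Pi.single v₀ (r - degree P))
    (Effective.add (fun v => le_max_left _ _) hs) (by rw [degree_add, degree_single]; ring)
  rw [linearSystem_top_eq_empty_of_lt hb fun v => ?_] at hne
  · exact Set.not_nonempty_empty hne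
  · have h1 := hs v
    have h2 : D v + 1 - b v ≤ P v := le_max_right _ _
    simp only [Pi.sub_apply, Pi.add_apply]
    omega

theorem exists_ge_degree_eq (D : Divisor V) {t : ℤ} (ht : degree D ≤ t) :
    ∃ D', D ≤ D' ∧ degree D' = t := by
  obtain ⟨v⟩ := ‹Nonempty V›
  refine ⟨D + Pi.single v (t - degree D), fun w => ?_, by rw [degree_add, degree_single]; ring⟩
  have := effective_single v (show 0 ≤ t - degree D by omega) w
  simp only [Pi.add_apply]
  omega

theorem notMem_rankSet_of_degree_lt {D : Divisor V} {k h : ℤ} {r : ℕ} (hk : 0 ≤ k)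
    (hk' : k + 2 ≤ Fintype.card V) (hh : 0 ≤ h) (hhk : h ≤ k) (hr : 2 * (r + h) = k * (k + 3))
    (hD : degree D < k * Fintype.card V - h) : r ∉ rankSet (⊤ : SimpleGraph V) D := by
  -- Rank sets grow with the divisor, so only the largest excluded degree matters.
  obtain ⟨D', hle, hD'⟩ := exists_ge_degree_eq D (t := k * Fintype.card V - h - 1) (by omega)
  refine mt (mem_rankSet_mono _ hle) ?_
  obtain ⟨b, hb, p, hp0, hp, hpos, hneg⟩ := exists_isBalancedResidues_bounds fun v => D' v + 1
  refine notMem_rankSet_of_sum_posPart_le hb ?_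
  have hsum := sum_posPart_sub_eq (D := D') hb
  rw [hD'] at hsum
  -- If n - p ≤ k + 1, the sum is at most k(k+1)/2, which is at most r because h ≤ k. Otherwise p ≤
  -- n - k - 2, and the bound p(p+1)/2 on the opposite part gives exactly r at the endpoint.
  rcases le_or_gt ((Fintype.card V : ℤ) - p) (k + 1) with hle | hlt
  · have := hneg (by omega)
    nlinarith
  · have := hpos (by omega)
    nlinarith

theorem notMem_rankSet_of_degree_lt_genus_add {D : Divisor V} {r : ℕ}
    (hr : ((Fintype.card V : ℤ) - 1) * (Fintype.card V - 2) ≤ 2 * r)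
    (hD : 2 * degree D < (Fintype.card V - 1) * (Fintype.card V - 2) + 2 * r) :
    r ∉ rankSet (⊤ : SimpleGraph V) D := by
  obtain ⟨g, hg⟩ : ∃ g, ((Fintype.card V : ℤ) - 1) * (Fintype.card V - 2) = 2 * g := by
    obtain ⟨g, hg⟩ := Int.even_mul_pred_self ((Fintype.card V : ℤ) - 1)
    exact ⟨g, by linarith⟩
  obtain ⟨D', hle, hD'⟩ := exists_ge_degree_eq D (t := g + r - 1) (by omega)
  refine mt (mem_rankSet_mono _ hle) ?_
  obtain ⟨b, hb, p, hp0, hp, hpos, hneg⟩ := exists_isBalancedResidues_bounds fun v => D' v + 1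
  refine notMem_rankSet_of_sum_posPart_le hb ?_
  have hsum := sum_posPart_sub_eq (D := D') hb
  rw [hD'] at hsum
  rcases hp0.eq_or_lt with rfl | hp1
  · have := hpos card_pos_int
    linarith
  · have h1 := hneg (by omega)
    -- The product equals (n-1)(n-2) - (n-p)(n-p-1), so the bound `h1` is at most 2g.
    have h2 : 0 ≤ (p - 1) * (2 * Fintype.card V - 2 - p) := by
      rcases (show 1 ≤ p by omega).eq_or_lt with rfl | hp2
      · simp
      · exact mul_nonneg (by omega) (by omega)
    nlinarith

end CompleteGraph

/-! ### Genus and the triangular representation of r -/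

theorem two_mul_ediv_two_of_even {a : ℤ} (h : Even a) : 2 * (a / 2) = a :=
  Int.mul_ediv_cancel' h.two_dvd

theorem two_mul_mul_add_three_ediv_two (k : ℤ) : 2 * (k * (k + 3) / 2) = k * (k + 3) :=
  two_mul_ediv_two_of_even (by rw [Int.even_mul]; grind)

theorem two_mul_genus_formula (n : ℤ) : 2 * ((n - 1) * (n - 2) / 2) = (n - 1) * (n - 2) :=
  two_mul_ediv_two_of_even (by rw [Int.even_mul]; grind)

theorem genus_top {V : Type*} [Fintype V] [DecidableEq V] :
    genus (⊤ : SimpleGraph V) = ((Fintype.card V : ℤ) - 1) * (Fintype.card V - 2) / 2 := by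
  rw [genus, SimpleGraph.card_edgeFinset_top_eq_card_choose_two]
  have h1 := two_mul_genus_formula (Fintype.card V)
  have h2 : 2 * ((Fintype.card V).choose 2 : ℤ) = Fintype.card V * (Fintype.card V - 1) := by
    rcases Nat.eq_zero_or_pos (Fintype.card V) with h | h
    · simp [h]
    · have h4 := Nat.choose_two_right (Fintype.card V)
      have h5 : 2 ∣ Fintype.card V * (Fintype.card V - 1) := (Nat.even_mul_pred_self _).two_dvd
      rw [h4, show (Fintype.card V : ℤ) - 1 = ((Fintype.card V - 1 : ℕ) : ℤ) by omega]
      exact_mod_cast Nat.mul_div_cancel' h5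
  linarith

/-- The blocks from k(k+1)/2 to k(k+3)/2 tile the positive integers: h counts down from k to 0, then
the next block begins. -/
theorem exists_triangular_rep (r : ℕ) :
    ∃ k h : ℤ, 1 ≤ k ∧ 0 ≤ h ∧ h ≤ k ∧ 2 * ((r : ℤ) + 1 + h) = k * (k + 3) := by
  induction r with
  | zero => exact ⟨1, 1, by norm_num⟩
  | succ r ih =>
    obtain ⟨k, h, hk, hh, hhk, hr⟩ := ih
    rcases hh.eq_or_lt with rfl | hpos
    · exact ⟨k + 1, k + 1, by omega, by omega, le_rfl, by push_cast; linarith⟩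
    · exact ⟨k, h - 1, hk, by omega, by omega, by push_cast; linarith⟩

theorem triangular_rep_le {k h k' h' : ℤ} (hk : 1 ≤ k) (hhk : h ≤ k) (hh' : 0 ≤ h')
    (heq : k * (k + 3) - 2 * h ≤ k' * (k' + 3) - 2 * h') (hk' : 1 ≤ k') : k ≤ k' := by
  by_contra hlt
  nlinarith [show k' + 1 ≤ k by omega]

theorem existsUnique_triangular_rep {n r : ℤ} (hr : 1 ≤ r) (hrn : r < (n - 1) * (n - 2) / 2)
    (hn : 1 ≤ n) :
    ∃! p : ℤ × ℤ, 1 ≤ p.1 ∧ p.1 ≤ n - 3 ∧ 0 ≤ p.2 ∧ p.2 ≤ p.1 ∧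
      r = p.1 * (p.1 + 3) / 2 - p.2 := by
  have hg := two_mul_genus_formula n
  obtain ⟨k, h, hk, hh, hhk, hrep⟩ := exists_triangular_rep (r - 1).toNat
  rw [Int.toNat_of_nonneg (by omega), sub_add_cancel] at hrep
  have hkn : k ≤ n - 3 := by
    by_contra hlt
    nlinarith [show n - 2 ≤ k by omega]
  refine ⟨(k, h), ⟨hk, hkn, hh, hhk, ?_⟩, ?_⟩
  · have := two_mul_mul_add_three_ediv_two k
    simp only
    omega
  · rintro ⟨k', h'⟩ ⟨h1, -, h3, h4, h5⟩
    simp only at h1 h3 h4 h5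
    have h6 := two_mul_mul_add_three_ediv_two k'
    have h7 : 2 * (r + h') = k' * (k' + 3) := by omega
    have hkk : k' = k := le_antisymm (triangular_rep_le h1 h4 hh (by linarith) hk)
      (triangular_rep_le hk hhk h3 (by linarith) h1)
    subst hkk
    simp only [Prod.mk.injEq, true_and]
    omega

/-! ### The gonality sequence -/

section Gonality

variable {V : Type*} [Fintype V] [Nonempty V]

theorem isGonality_of {G : SimpleGraph V} [DecidableRel G.Adj] {r : ℕ} {s : ℤ} {D : Divisor V}
    (hdeg : degree D = s) (hmem : r ∈ rankSet G D) (hnot : r + 1 ∉ rankSet G D)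
    (hlt : ∀ D', degree D' < s → r ∉ rankSet G D') : IsGonality G r s := by
  refine ⟨⟨D, hdeg, rank_eq_of_mem_of_notMem G hmem hnot⟩, ?_⟩
  rintro t ⟨D', rfl, hD'⟩
  by_contra hcon
  exact hlt D' (not_le.1 hcon) (mem_rankSet_of_rank_eq G hD')

variable [DecidableEq V]

theorem isGonality_top_of_lt_genus {r : ℕ} {k h : ℤ} (hk : 1 ≤ k) (hkn : k ≤ Fintype.card V - 3)
    (hh : 0 ≤ h) (hhk : h ≤ k) (hr : 2 * (r + h) = k * (k + 3)) :
    IsGonality (⊤ : SimpleGraph V) r (k * Fintype.card V - h) := by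
  obtain ⟨v⟩ := ‹Nonempty V›
  have : Nonempty V := ⟨v⟩
  have hdeg : degree ((fun _ => k) - Pi.single v h : Divisor V) = k * Fintype.card V - h := by
    rw [degree_sub, degree_single]
    simp [degree, mul_comm]
  refine isGonality_of hdeg (mem_rankSet_const_sub (by omega) (by omega) (effective_single v hh)
    rfl (by rw [degree_single, hr])) ?_ fun D' hD' =>
      notMem_rankSet_of_degree_lt (by omega) (by omega) hh hhk hr hD'
  -- The rank is exactly r because the degree is below the threshold for r + 1, whose parameters are
  -- (k+1, k+1) if h = 0 and (k, h-1) otherwise. The former is where k ≤ n - 3 is needed.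
  rcases hh.eq_or_lt with rfl | hpos
  · exact notMem_rankSet_of_degree_lt (k := k + 1) (h := k + 1) (by omega) (by omega) (by omega)
      le_rfl (by push_cast; linarith) (by rw [hdeg]; linarith)
  · exact notMem_rankSet_of_degree_lt (k := k) (h := h - 1) (by omega) (by omega) (by omega)
      (by omega) (by push_cast; linarith) (by rw [hdeg]; linarith)

theorem isGonality_top_of_genus_le {r : ℕ} {g : ℤ}
    (hg : 2 * g = ((Fintype.card V : ℤ) - 1) * (Fintype.card V - 2)) (hr : g ≤ r) :
    IsGonality (⊤ : SimpleGraph V) r (g + r) := by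
  obtain ⟨v⟩ := ‹Nonempty V›
  have : Nonempty V := ⟨v⟩
  refine isGonality_of (degree_single v _) (mem_rankSet_of_le_degree ?_)
    (notMem_rankSet_of_degree_lt_genus_add ?_ ?_) fun D' hD' =>
      notMem_rankSet_of_degree_lt_genus_add ?_ ?_
  all_goals
    try rw [degree_single]
    rw [← hg]
    push_cast
    omega

end Gonality

end GraphDiv

theorem theorem1p1 (d : ℕ) (hd : 1 ≤ d) :
    GraphDiv.genus (⊤ : SimpleGraph (Fin d)) = (((d : ℤ) - 1) * ((d : ℤ) - 2)) / 2 ∧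
    ∀ r : ℤ, 1 ≤ r →
      (r < (((d : ℤ) - 1) * ((d : ℤ) - 2)) / 2 →
        (∃! p : ℤ × ℤ, 1 ≤ p.1 ∧ p.1 ≤ (d : ℤ) - 3 ∧ 0 ≤ p.2 ∧ p.2 ≤ p.1 ∧
          r = p.1 * (p.1 + 3) / 2 - p.2) ∧
        ∀ k h : ℤ, 1 ≤ k → k ≤ (d : ℤ) - 3 → 0 ≤ h → h ≤ k → r = k * (k + 3) / 2 - h →
          GraphDiv.IsGonality (⊤ : SimpleGraph (Fin d)) r (k * (d : ℤ) - h)) ∧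
      ((((d : ℤ) - 1) * ((d : ℤ) - 2)) / 2 ≤ r →
        GraphDiv.IsGonality (⊤ : SimpleGraph (Fin d)) r
          ((((d : ℤ) - 1) * ((d : ℤ) - 2)) / 2 + r)) := by
  have : Nonempty (Fin d) := ⟨⟨0, hd⟩⟩
  have hg := GraphDiv.two_mul_genus_formula d
  refine ⟨by simpa using GraphDiv.genus_top (V := Fin d), fun r hr => ?_⟩
  lift r to ℕ using by omega
  refine ⟨fun hlt => ⟨GraphDiv.existsUnique_triangular_rep hr hlt (by omega), ?_⟩, fun hle => ?_⟩
  · intro k h hk hkd hh hhk hrep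
    have h1 := GraphDiv.two_mul_mul_add_three_ediv_two k
    simpa using GraphDiv.isGonality_top_of_lt_genus (V := Fin d) (r := r) hk (by simpa using hkd)
      hh hhk (by omega)
  · exact GraphDiv.isGonality_top_of_genus_le (V := Fin d) (by simpa using hg) hle
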